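/- Consider the schema of directed graphs with one binary relation symbol $E$ and two constant symbols $s,t$. Let $\mathcal Q$ be the Boolean query on finite structures of this schema that is defined by the $\exists^*\forall^*$ first-order formula $$\varphi \;=\; \exists x\,\forall y\,\bigl(E(s,x)\wedge (E(y,t)\rightarrow E(x,y))\bigr).$$ Then $\mathcal Q$ is an $\exists^*\forall^*\mathrm{FO}$-definable query that cannot be maintained by any DynProp program, whatever the arity of its auxiliary relations. Here a dynamic program over an input schema $\tau_{\mathrm{in}}$ consists of a finite relational auxiliary schema $\tau_{\mathrm{aux}}$ (arities arbitrary, possibly $0$); for every relation symbol $S$ of $\tau_{\mathrm{in}}$, every operation $\delta\in\{\mathrm{ins}_S,\mathrm{del}_S\}$ and every $R\in\tau_{\mathrm{aux}}$, a first-order update formula $\phi^R_\delta(\bar x;\bar y)$ over $\tau_{\mathrm{in}}\cup\tau_{\mathrm{aux}}$, where $\bar x$, $\bar y$ have the arities of $S$, $R$; an arbitrary initialization mapping $\mathrm{Init}$ that assigns to each finite $\tau_{\mathrm{in}}$-database an auxiliary database over the same domain; and a designated query symbol $Q\in\tau_{\mathrm{aux}}$ of the arity of the query. A state consists of a finite domain,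 an input database and an auxiliary database. A modification $\delta(\bar a)$ with $\delta=\mathrm{ins}_S$ (resp. $\mathrm{del}_S$) inserts $\bar a$ into (resp. deletes $\bar a$ from) the relation $S$ of the input database and simultaneously replaces each auxiliary relation $R$ by $\{\bar b : \phi^R_\delta(\bar a;\bar b)\text{ holds in the state before the modification}\}$. The program maintains a query if, for every database $\mathcal D$ over a finite domain and every finite sequence $\alpha$ of insertions and deletions, starting from $(\mathcal D,\mathrm{Init}(\mathcal D))$ and applying $\alpha$ leads to a state in which the relation $Q$ is the result of the query on $\alpha(\mathcal D)$. A DynProp program is a dynamic program all of whose update formulas are quantifier-free. -/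

import Mathlib

namespace DynComplexity

open FirstOrder FirstOrder.Language

/-- A modification of a database of schema `L` over the domain `D`: the insertion of a tuple into,
or the deletion of a tuple from, one of the relations. -/
inductive Modification (L : FirstOrder.Language.{0, 0}) (D : Type) : Type
  | ins {m : ℕ} (S : L.Relations m) (a : Fin m → D) : Modification L D
  | del {m : ℕ} (S : L.Relations m) (a : Fin m → D) : Modification L D

/-- The database `α(I)` obtained by applying the modification `α` to the database `I`.
Constants (and all other function symbols) keep their interpretation. -/
@[reducible] def Modification.apply {L : FirstOrder.Language.{0, 0}} {D : Type} (I : L.Structure D) :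
    Modification L D → L.Structure D
  | .ins (m := m) S a =>
    { funMap := I.funMap
      RelMap := fun {n} R v => I.RelMap R v ∨
        (⟨n, R, v⟩ : Σ n, L.Relations n × (Fin n → D)) = ⟨m, S, a⟩ }
  | .del (m := m) S a =>
    { funMap := I.funMap
      RelMap := fun {n} R v => I.RelMap R v ∧
        (⟨n, R, v⟩ : Σ n, L.Relations n × (Fin n → D)) ≠ ⟨m, S, a⟩ }

/-- Apply a sequence of modifications to a database, the head of the list first. -/
@[reducible] def applySeq {L : FirstOrder.Language.{0, 0}} {D : Type} (I : L.Structure D)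
    (α : List (Modification L D)) : L.Structure D :=
  α.foldl Modification.apply I

/-- An `r`-ary query over the schema `L`: it assigns to every database over a finite domain an
`r`-ary relation on that domain. For `r = 0` this is a Boolean query. -/
abbrev Query (L : FirstOrder.Language.{0, 0}) (r : ℕ) : Type 1 :=
  ∀ (D : Type) [Finite D], L.Structure D → Set (Fin r → D)

/-- The query defined by a first-order formula. -/
def Query.ofFormula {L : FirstOrder.Language.{0, 0}} {r : ℕ} (φ : L.Formula (Fin r)) : Query L r :=
  fun _ _ I => {v | letI := I; φ.Realize v}

/-- Formulas of the form `∃ x₁ … ∃ xₘ ∀ y₁ … ∀ yₙ ψ` with `ψ` quantifier-free. -/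
inductive IsExistsForall {L : FirstOrder.Language.{0, 0}} {V : Type} :
    ∀ {n : ℕ}, L.BoundedFormula V n → Prop
  | of_isUniversal {n : ℕ} {φ : L.BoundedFormula V n} (h : φ.IsUniversal) : IsExistsForall φ
  | ex {n : ℕ} {φ : L.BoundedFormula V (n + 1)} (h : IsExistsForall φ) : IsExistsForall φ.ex

/-- The query is definable by an `∃*∀*` first-order formula. -/
def IsExistsForallDefinable {L : FirstOrder.Language.{0, 0}} {r : ℕ} (Q : Query L r) : Prop :=
  ∃ φ : L.Formula (Fin r), IsExistsForall φ ∧ Q = Query.ofFormula φ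

/-- A dynamic program for `r`-ary queries over the input schema `L`. The auxiliary schema is a
finite relational schema. For every auxiliary relation symbol `R` and every operation `ins_S` or
`del_S` there is an update formula over the union of both schemas, whose free variables are
`Sum.inl i` for the modified tuple and `Sum.inr j` for the updated tuple. The initialization is an
arbitrary mapping, and `query` is the designated query symbol. -/
structure DynProgram (L : FirstOrder.Language.{0, 0}) (r : ℕ) : Type 1 where
  aux : FirstOrder.Language.{0, 0}
  aux_isRelational : aux.IsRelational
  aux_finite : Finite (Σ n, aux.Relations n)
  insFormula : ∀ {m n : ℕ}, L.Relations m → aux.Relations n →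
    (L.sum aux).Formula (Fin m ⊕ Fin n)
  delFormula : ∀ {m n : ℕ}, L.Relations m → aux.Relations n →
    (L.sum aux).Formula (Fin m ⊕ Fin n)
  init : ∀ (D : Type) [Finite D], L.Structure D → aux.Structure D
  query : aux.Relations r

namespace DynProgram

variable {L : FirstOrder.Language.{0, 0}} {r : ℕ}

/-- No update formula contains a quantifier. -/
def IsQuantifierFree (P : DynProgram L r) : Prop :=
  ∀ {m n : ℕ} (S : L.Relations m) (R : P.aux.Relations n),
    (P.insFormula S R).IsQF ∧ (P.delFormula S R).IsQF

/-- A program state over the domain `D`: the current database and the auxiliary database. -/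
structure State (P : DynProgram L r) (D : Type) : Type where
  input : L.Structure D
  auxDB : P.aux.Structure D

/-- The formula `φ` holds in the state `T` for the modified tuple `a` and the updated tuple `b`. -/
def State.Holds {P : DynProgram L r} {D : Type} (T : P.State D) {m n : ℕ}
    (φ : (L.sum P.aux).Formula (Fin m ⊕ Fin n)) (a : Fin m → D) (b : Fin n → D) : Prop :=
  letI := T.input
  letI := T.auxDB
  φ.Realize (Sum.elim a b)

/-- The auxiliary database after a modification; all update formulas are evaluated in the state
before the modification. -/
@[reducible] def newAux (P : DynProgram L r) {D : Type} (T : P.State D) :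
    Modification L D → P.aux.Structure D
  | .ins S a =>
    { funMap := T.auxDB.funMap
      RelMap := fun R b => T.Holds (P.insFormula S R) a b }
  | .del S a =>
    { funMap := T.auxDB.funMap
      RelMap := fun R b => T.Holds (P.delFormula S R) a b }

/-- The state that the program reaches from `T` under one modification. -/
def step (P : DynProgram L r) {D : Type} (T : P.State D) (α : Modification L D) : P.State D :=
  ⟨α.apply T.input, P.newAux T α⟩

/-- The state that the program reaches from `T` under a sequence of modifications. -/
def run (P : DynProgram L r) {D : Type} (T : P.State D) (α : List (Modification L D)) :
    P.State D :=
  α.foldl P.step T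

/-- The initial state for the input database `I`. -/
def initState (P : DynProgram L r) (D : Type) [Finite D] (I : L.Structure D) : P.State D :=
  ⟨I, P.init D I⟩

/-- The program maintains the query `Q`: for every database over a finite domain and every sequence
of modifications, the query relation in the reached state is the answer of `Q` on the modified
database. -/
def Maintains (P : DynProgram L r) (Q : Query L r) : Prop :=
  ∀ (D : Type) [Finite D] (I : L.Structure D) (α : List (Modification L D)),
    {v : Fin r → D | (P.run (P.initState D I) α).auxDB.RelMap P.query v} = Q D (applySeq I α)

end DynProgram

/-- The query belongs to the class DynProp. -/
def InDynProp {L : FirstOrder.Language.{0, 0}} {r : ℕ} (Q : Query L r) : Prop :=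
  ∃ P : DynProgram L r, P.IsQuantifierFree ∧ P.Maintains Q

/-- The two constant symbols `s` and `t`. -/
inductive STFunctions : ℕ → Type
  | s : STFunctions 0
  | t : STFunctions 0

/-- The single binary relation symbol `E`. -/
inductive STRelations : ℕ → Type
  | E : STRelations 2

/-- The schema of directed graphs with two constants `s` and `t`. -/
def stGraph : FirstOrder.Language.{0, 0} := ⟨STFunctions, STRelations⟩

/-- The constant symbol `s`. -/
def symS : stGraph.Constants := STFunctions.s

/-- The constant symbol `t`. -/
def symT : stGraph.Constants := STFunctions.t

/-- The edge relation symbol `E`. -/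
def symE : stGraph.Relations 2 := STRelations.E

/-- The formula `∃ x ∀ y (E(s, x) ∧ (E(y, t) → E(x, y)))`; here `&0` is `x` and `&1` is `y`. -/
def stFormula : stGraph.Formula (Fin 0) :=
  ∃' ∀' (symE.boundedFormula₂ symS.term (&0) ⊓
    (symE.boundedFormula₂ (&1) symT.term ⟹ symE.boundedFormula₂ (&0) (&1)))

/-- The Boolean query defined by `∃ x ∀ y (E(s, x) ∧ (E(y, t) → E(x, y)))`. -/
def stQuery : Query stGraph 0 := Query.ofFormula stFormula

end DynComplexity

/-! ### Locality of quantifier-free updates -/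

namespace DynComplexity

open FirstOrder FirstOrder.Language

/-! The proof is a counting argument. A quantifier-free program that modifies only tuples over a set
`A` containing the constants never looks outside `A`, so its Boolean answer depends only on the
initial state restricted to `A` (`State.AgreeOn.run`). Take auxiliary arities at most `m`, and a
grid of `m + 1` columns of `n` vertices. A set `B` of choice functions is encoded by the edges from
the source to selectors, which lie outside the core `A`, so the input graph on `A` does not depend
on `B`. Yet linking the grid vertices chosen by `f` to the target, a modification inside `A`, turns
the query into the question `f ∈ B` (`mem_stQuery_linkColumns_iff`). Hence the initial auxiliary
data on the core must determine `B`. That is `n ^ (m + 1)` bits of information, while relations of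
arity at most `m` on `O(n)` vertices hold only `O(n ^ m)` bits. Arbitrary initialization does not
help. -/

/-- The set `A` is closed under the functions of `S`, and `S` and `S'` induce the same substructure
on `A`. -/
structure AgreeOn {L : FirstOrder.Language.{0, 0}} {D : Type} (A : Set D)
    (S S' : L.Structure D) : Prop where
  funMap_mem : ∀ {n : ℕ} (f : L.Functions n) (v : Fin n → D), (∀ i, v i ∈ A) → S.funMap f v ∈ A
  funMap_eq : ∀ {n : ℕ} (f : L.Functions n) (v : Fin n → D), (∀ i, v i ∈ A) →
    S.funMap f v = S'.funMap f v
  relMap_iff : ∀ {n : ℕ} (R : L.Relations n) (v : Fin n → D), (∀ i, v i ∈ A) →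
    (S.RelMap R v ↔ S'.RelMap R v)

namespace AgreeOn

variable {L L' : FirstOrder.Language.{0, 0}} {D : Type} {A : Set D}

theorem sum {S S' : L.Structure D} {T T' : L'.Structure D} (hS : AgreeOn A S S')
    (hT : AgreeOn A T T') :
    AgreeOn A (@Language.sumStructure L L' D S T) (@Language.sumStructure L L' D S' T') where
  funMap_mem := by
    rintro n (f | f) v hv
    · exact hS.funMap_mem f v hv
    · exact hT.funMap_mem f v hv
  funMap_eq := by
    rintro n (f | f) v hv
    · exact hS.funMap_eq f v hv
    · exact hT.funMap_eq f v hv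
  relMap_iff := by
    rintro n (R | R) v hv
    · exact hS.relMap_iff R v hv
    · exact hT.relMap_iff R v hv

theorem term_realize {S S' : L.Structure D} (h : AgreeOn A S S') {V : Type} (t : L.Term V)
    (v : V → D) (hv : ∀ i, v i ∈ A) :
    @Term.realize L D S V v t ∈ A ∧ @Term.realize L D S V v t = @Term.realize L D S' V v t := by
  induction t with
  | var i => exact ⟨hv i, rfl⟩
  | func f ts ih =>
    simp only [Term.realize]
    refine ⟨h.funMap_mem f _ fun i => (ih i).1, ?_⟩
    rw [h.funMap_eq f _ fun i => (ih i).1]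
    congr 1
    exact funext fun i => (ih i).2

/-- Without quantifiers, only values of terms at tuples over `A` are inspected, and closure under
functions keeps these in `A`. -/
theorem realize_iff {S S' : L.Structure D} (h : AgreeOn A S S') {V : Type} {n : ℕ}
    {φ : L.BoundedFormula V n} (hφ : φ.IsQF) (v : V → D) (w : Fin n → D) (hv : ∀ i, v i ∈ A)
    (hw : ∀ i, w i ∈ A) :
    @BoundedFormula.Realize L D S V n φ v w ↔ @BoundedFormula.Realize L D S' V n φ v w := by
  have hvw : ∀ i, Sum.elim v w i ∈ A := by
    rintro (i | i)
    · exact hv i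
    · exact hw i
  induction hφ with
  | falsum => exact Iff.rfl
  | of_isAtomic ha =>
    cases ha with
    | equal t₁ t₂ =>
      simp only [Term.bdEqual, BoundedFormula.Realize]
      rw [(h.term_realize t₁ _ hvw).2, (h.term_realize t₂ _ hvw).2]
    | rel R ts =>
      simp only [Relations.boundedFormula, BoundedFormula.Realize]
      rw [h.relMap_iff R _ fun i => (h.term_realize (ts i) _ hvw).1,
        funext fun i => (h.term_realize (ts i) _ hvw).2]
  | imp _ _ ih₁ ih₂ =>
    exact imp_congr ih₁ ih₂

end AgreeOn

/-- All entries of the modified tuple belong to `A`. -/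
def Modification.Within {L : FirstOrder.Language.{0, 0}} {D : Type} (A : Set D) :
    Modification L D → Prop
  | .ins _ a => ∀ i, a i ∈ A
  | .del _ a => ∀ i, a i ∈ A

theorem AgreeOn.apply {L : FirstOrder.Language.{0, 0}} {D : Type} {A : Set D}
    {S S' : L.Structure D} (h : AgreeOn A S S') (α : Modification L D) :
    AgreeOn A (α.apply S) (α.apply S') := by
  cases α with
  | ins R a =>
    exact ⟨h.funMap_mem, h.funMap_eq, fun R v hv => or_congr (h.relMap_iff R v hv) Iff.rfl⟩
  | del R a =>
    exact ⟨h.funMap_mem, h.funMap_eq, fun R v hv => and_congr (h.relMap_iff R v hv) Iff.rfl⟩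

namespace DynProgram

variable {L : FirstOrder.Language.{0, 0}} {r : ℕ} {P : DynProgram L r} {D : Type} {A : Set D}

/-- Two states whose input and auxiliary databases agree on `A`. -/
structure State.AgreeOn (A : Set D) (T T' : P.State D) : Prop where
  input : DynComplexity.AgreeOn A T.input T'.input
  auxDB : DynComplexity.AgreeOn A T.auxDB T'.auxDB

theorem State.AgreeOn.holds_iff {T T' : P.State D} (h : T.AgreeOn A T') {m n : ℕ}
    {φ : (L.sum P.aux).Formula (Fin m ⊕ Fin n)} (hφ : φ.IsQF) {a : Fin m → D} {b : Fin n → D}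
    (ha : ∀ i, a i ∈ A) (hb : ∀ i, b i ∈ A) : T.Holds φ a b ↔ T'.Holds φ a b := by
  refine (h.input.sum h.auxDB).realize_iff hφ _ _ ?_ fun i => i.elim0
  rintro (i | i)
  · exact ha i
  · exact hb i

theorem State.AgreeOn.step (hP : P.IsQuantifierFree) {T T' : P.State D} (h : T.AgreeOn A T')
    {α : Modification L D} (hα : α.Within A) : (P.step T α).AgreeOn A (P.step T' α) := by
  refine ⟨h.input.apply α, ?_⟩
  cases α with
  | ins R a =>
    exact ⟨h.auxDB.funMap_mem, h.auxDB.funMap_eq,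
      fun R' b hb => h.holds_iff (hP R R').1 hα hb⟩
  | del R a =>
    exact ⟨h.auxDB.funMap_mem, h.auxDB.funMap_eq,
      fun R' b hb => h.holds_iff (hP R R').2 hα hb⟩

/-- A quantifier-free program acts on the substructure induced by `A` independently of the rest of
the state, as long as only tuples over `A` are modified. -/
theorem State.AgreeOn.run (hP : P.IsQuantifierFree) {T T' : P.State D} (h : T.AgreeOn A T')
    {α : List (Modification L D)} (hα : ∀ β ∈ α, β.Within A) :
    (P.run T α).AgreeOn A (P.run T' α) := by
  induction α generalizing T T' with
  | nil => exact h
  | cons β α ih =>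
    exact ih (h.step hP (hα β (by simp))) fun γ hγ => hα γ (by simp [hγ])

theorem exists_arity_lt (P : DynProgram L r) :
    ∃ m : ℕ, ∀ R : Σ n, P.aux.Relations n, R.1 < m + 1 := by
  have := P.aux_finite
  obtain ⟨m, hm⟩ := (Set.finite_range fun R : Σ n, P.aux.Relations n => R.1).bddAbove
  exact ⟨m, fun R => Nat.lt_succ_of_le (hm ⟨R, rfl⟩)⟩

end DynProgram

/-! ### Definability and meaning of the query -/

theorem isExistsForallDefinable_stQuery : IsExistsForallDefinable stQuery := by
  refine ⟨stFormula, .ex (.of_isUniversal (.all (.of_isQF ?_))), rfl⟩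
  exact (BoundedFormula.IsAtomic.rel _ _).isQF.inf
    ((BoundedFormula.IsAtomic.rel _ _).isQF.imp (BoundedFormula.IsAtomic.rel _ _).isQF)

theorem mem_stQuery_iff {D : Type} [Finite D] (I : stGraph.Structure D) (v : Fin 0 → D) :
    v ∈ stQuery D I ↔ ∃ x, ∀ y, I.RelMap symE ![I.funMap symS ![], x] ∧
      (I.RelMap symE ![y, (I.funMap symT ![])] → I.RelMap symE ![x, y]) := by
  let _ := I
  simp only [stQuery, Query.ofFormula, stFormula, Set.mem_ofPred_eq, Formula.Realize,
    BoundedFormula.realize_ex, BoundedFormula.realize_all, BoundedFormula.realize_inf,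
    BoundedFormula.realize_imp, BoundedFormula.realize_rel₂, Constants.term, Term.realize_func]
  have h : ∀ (c : stGraph.Constants) (w : Fin 0 → D), I.funMap c w = I.funMap c ![] :=
    fun c w => congrArg _ (Subsingleton.elim _ _)
  refine exists_congr fun x => forall_congr' fun y => ?_
  rw [h symS, h symT]
  rfl

/-! ### The gadget graph -/

/-- The vertices of the gadget graph: the two terminals, a grid with `m` columns of `n` vertices
each, and a selector for every choice of one grid vertex per column. -/
inductive Vertex (m n : ℕ) : Type
  | source
  | target
  | grid (i : Fin m) (j : Fin n)
  | selector (g : Fin m → Fin n)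

namespace Vertex

variable {m n : ℕ}

/-- Vertices as elements of a sum type. -/
def equivSum (m n : ℕ) : Vertex m n ≃ (Unit ⊕ Unit) ⊕ (Fin m × Fin n) ⊕ (Fin m → Fin n) where
  toFun
    | source => .inl (.inl ())
    | target => .inl (.inr ())
    | grid i j => .inr (.inl (i, j))
    | selector g => .inr (.inr g)
  invFun
    | .inl (.inl _) => source
    | .inl (.inr _) => target
    | .inr (.inl p) => grid p.1 p.2
    | .inr (.inr g) => selector g
  left_inv := by rintro (_ | _ | _ | _) <;> rfl
  right_inv := by rintro ((_ | _) | _ | _) <;> rfl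

instance : Finite (Vertex m n) := Finite.of_equiv _ (equivSum m n).symm

/-- The vertices other than the selectors. -/
def core (m n : ℕ) : Set (Vertex m n) := {v | ∀ g, v ≠ selector g}

/-- A selector is adjacent to the grid vertices it selects; the source is adjacent to the
selectors in `B`. -/
def Adj (B : Set (Fin m → Fin n)) : Vertex m n → Vertex m n → Prop
  | source, selector g => g ∈ B
  | selector g, grid i j => g i = j
  | _, _ => False

/-- The gadget graph as a database. -/
@[reducible] def database (B : Set (Fin m → Fin n)) : stGraph.Structure (Vertex m n) where
  funMap
    | STFunctions.s, _ => source
    | STFunctions.t, _ => target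
  RelMap
    | STRelations.E, v => Adj B (v 0) (v 1)

/-- Every edge of the gadget has a selector as an endpoint, so the core carries no edges, whatever
the set of marked selectors. -/
theorem agreeOn_database (B B' : Set (Fin m → Fin n)) :
    AgreeOn (core m n) (database B) (database B') where
  funMap_mem := by rintro _ (_ | _) v - g ⟨⟩
  funMap_eq := by rintro _ (_ | _) v - <;> rfl
  relMap_iff := by
    rintro _ ⟨⟩ v hv
    change Adj B (v 0) (v 1) ↔ Adj B' (v 0) (v 1)
    have h₀ := hv 0
    have h₁ := hv 1
    revert h₀ h₁
    cases v 0 <;> cases v 1 <;> simp [core, Adj]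

/-- Insert the edges from the grid vertices selected by `f` in the given columns to the target. -/
def linkColumns (f : Fin m → Fin n) (l : List (Fin m)) : List (Modification stGraph (Vertex m n)) :=
  l.map fun i => .ins symE ![grid i (f i), target]

theorem within_linkColumns (f : Fin m → Fin n) (l : List (Fin m)) :
    ∀ β ∈ linkColumns f l, β.Within (core m n) := by
  intro β hβ
  obtain ⟨i, -, rfl⟩ := List.mem_map.1 hβ
  intro j
  fin_cases j <;> simp [core]

theorem funMap_applySeq_linkColumns (I : stGraph.Structure (Vertex m n)) (f : Fin m → Fin n)
    (l : List (Fin m)) {k : ℕ} (c : stGraph.Functions k) (v : Fin k → Vertex m n) :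
    (applySeq I (linkColumns f l)).funMap c v = I.funMap c v := by
  induction l generalizing I with
  | nil => rfl
  | cons i l ih => exact ih _

theorem relMap_applySeq_linkColumns (I : stGraph.Structure (Vertex m n)) (f : Fin m → Fin n)
    (l : List (Fin m)) (x y : Vertex m n) :
    (applySeq I (linkColumns f l)).RelMap symE ![x, y] ↔
      I.RelMap symE ![x, y] ∨ ∃ i ∈ l, x = grid i (f i) ∧ y = target := by
  induction l generalizing I with
  | nil => exact (or_iff_left (by simp)).symm
  | cons i l ih =>
    refine (ih _).trans ?_
    have h : (Modification.apply I (.ins symE ![grid i (f i), target])).RelMap symE ![x, y] ↔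
        I.RelMap symE ![x, y] ∨ x = grid i (f i) ∧ y = target :=
      or_congr Iff.rfl (by simp)
    rw [h, or_assoc]
    simp

/-- The predecessors of the target are now exactly the vertices `grid i (f i)`. A witness is a
successor of the source, hence a selector in `B`, and it must be adjacent to all of them, which
forces it to be the selector of `f`. -/
theorem mem_stQuery_linkColumns_iff (B : Set (Fin m → Fin n)) (f : Fin m → Fin n)
    (v : Fin 0 → Vertex m n) :
    v ∈ stQuery _ (applySeq (database B) (linkColumns f (List.finRange m))) ↔ f ∈ B := by
  have hs : (database B).funMap symS ![] = source := rfl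
  have ht : (database B).funMap symT ![] = target := rfl
  have hE : ∀ x y, (database B).RelMap symE ![x, y] ↔ Adj B x y := fun _ _ => Iff.rfl
  rw [mem_stQuery_iff]
  simp only [funMap_applySeq_linkColumns, relMap_applySeq_linkColumns, hs, ht, hE]
  constructor
  · rintro ⟨x, hx⟩
    have hsx := (hx source).1
    have hg := fun i => (hx (grid i (f i))).2 (Or.inr ⟨i, List.mem_finRange i, rfl, trivial⟩)
    cases x with
    | selector g =>
      have hfg : g = f := funext fun i => by simpa [Adj] using hg i
      simpa [Adj, hfg] using hsx
    | _ => simp [Adj] at hsx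
  · intro hf
    refine ⟨selector f, fun y => ⟨Or.inl hf, ?_⟩⟩
    rintro (h | ⟨i, -, rfl, -⟩)
    -- No edge of the original gadget enters the target.
    · cases y <;> simp [Adj] at h
    · exact Or.inl rfl

/-- Linear in `n` for fixed `m`: the `n ^ m` selectors are left out. -/
theorem card_core : Nat.card (core m n) ≤ m * n + 2 := by
  let e : core m n → (Unit ⊕ Unit) ⊕ (Fin m × Fin n) := fun v =>
    match v with
    | ⟨source, _⟩ => .inl (.inl ())
    | ⟨target, _⟩ => .inl (.inr ())
    | ⟨grid i j, _⟩ => .inr (i, j)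
    | ⟨selector g, h⟩ => (h g rfl).elim
  have he : Function.Injective e := by
    rintro ⟨v, hv⟩ ⟨w, hw⟩ h
    cases v with
    | selector g => exact (hv g rfl).elim
    | _ =>
      cases w with
      | selector g => exact (hw g rfl).elim
      | _ => simp_all [e]
  refine (Nat.card_le_card_of_injective e he).trans ?_
  simp
  omega

end Vertex

/-! ### Counting and the contradiction -/

/-- A bound on the number of pairs of an index and a tuple over `A` of the arity of that index. -/
theorem card_sigma_tuples_le {ι A : Type} [Finite ι] [Finite A] (ar : ι → ℕ) {m N : ℕ}
    (har : ∀ i, ar i ≤ m) (hA : Nat.card A ≤ N) (hN : 0 < N) :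
    Nat.card (Σ i, Fin (ar i) → A) ≤ Nat.card ι * N ^ m := by
  have := Fintype.ofFinite ι
  rw [Nat.card_sigma]
  calc ∑ i, Nat.card (Fin (ar i) → A) ≤ ∑ _i : ι, N ^ m := by
        refine Finset.sum_le_sum fun i _ => ?_
        rw [Nat.card_fun, Nat.card_fin]
        exact (Nat.pow_le_pow_left hA _).trans (Nat.pow_le_pow_right hN (har i))
    _ = Nat.card ι * N ^ m := by simp

theorem card_le_of_injective_set {F G : Type} [Finite F] [Finite G] (f : Set F → Set G)
    (hf : Function.Injective f) : Nat.card F ≤ Nat.card G := by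
  have := Fintype.ofFinite F
  have := Fintype.ofFinite G
  have h := Nat.card_le_card_of_injective f hf
  simp only [Nat.card_eq_fintype_card, Fintype.card_set] at h ⊢
  exact (Nat.pow_le_pow_iff_right (by norm_num)).1 h

open Vertex in
theorem not_inDynProp_stQuery : ¬ InDynProp stQuery := by
  rintro ⟨P, hP, hM⟩
  have := P.aux_finite
  have hrel := P.aux_isRelational
  obtain ⟨m, hm⟩ := P.exists_arity_lt
  set c := Nat.card (Σ k, P.aux.Relations k)
  -- Chosen so that `n ^ (m + 1)` exceeds `c * ((m + 3) * n) ^ m`, the bound on the number of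
  -- auxiliary bits over the core.
  set n := c * (m + 3) ^ m + 1 with hn
  -- The initial auxiliary database restricted to the core, as a set of pairs of a symbol and a
  -- tuple.
  let restr : Set (Fin (m + 1) → Fin n) →
      Set (Σ R : Σ k, P.aux.Relations k, Fin R.1 → core (m + 1) n) := fun B =>
    {p | (P.init _ (database B)).RelMap p.1.2 fun i => (p.2 i : Vertex (m + 1) n)}
  have hinj : Function.Injective restr := by
    intro B B' hB
    have hagree : (P.initState _ (database B)).AgreeOn (core (m + 1) n)
        (P.initState _ (database B')) := by
      refine ⟨agreeOn_database B B', fun f => isEmptyElim f, fun f => isEmptyElim f, ?_⟩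
      intro k R v hv
      exact Set.ext_iff.1 hB ⟨⟨k, R⟩, fun i => ⟨v i, hv i⟩⟩
    ext f
    have h := (hagree.run hP (within_linkColumns f (List.finRange _))).auxDB.relMap_iff P.query
      ![] fun i => i.elim0
    rw [← mem_stQuery_linkColumns_iff B f ![], ← mem_stQuery_linkColumns_iff B' f ![], ← hM, ← hM]
    exact h
  have hN : (m + 1) * n + 2 ≤ (m + 3) * n := by
    have : 1 ≤ n := Nat.succ_pos _
    linarith [add_mul (m + 1) 2 n]
  have hcard := (card_le_of_injective_set restr hinj).trans
    (card_sigma_tuples_le (fun R : Σ k, P.aux.Relations k => R.1) (m := m)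
      (N := (m + 3) * n) (fun R => Nat.le_of_lt_succ (hm R))
      (card_core.trans hN) (by positivity))
  rw [Nat.card_fun, Nat.card_fin, Nat.card_fin, mul_pow, ← mul_assoc, pow_succ'] at hcard
  -- Cancelling `n ^ m` leaves `n ≤ c * (m + 3) ^ m`.
  have := Nat.le_of_mul_le_mul_right hcard (by positivity)
  exact absurd this (Nat.not_le_of_lt (Nat.lt_succ_self _))

end DynComplexity

theorem theorem5p4 :
    DynComplexity.IsExistsForallDefinable DynComplexity.stQuery ∧
      ¬ DynComplexity.InDynProp DynComplexity.stQuery :=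
  ⟨DynComplexity.isExistsForallDefinable_stQuery, DynComplexity.not_inDynProp_stQuery⟩
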